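/- Let $n\ge 2$, write $[n]=\{1,\dots,n\}$, and let $\tilde S_n$ be the affine symmetric group: the group of bijections $w:\mathbb Z\to\mathbb Z$ with $w(i+n)=w(i)+n$ for all $i\in\mathbb Z$ and $\sum_{i\in[n]}w(i)=\sum_{i\in[n]}i$. For $0\le i<n$ let $s_i\in\tilde S_n$ be the permutation with $j\mapsto j+1$ if $j\equiv i \pmod n$, $j\mapsto j-1$ if $j\equiv i+1\pmod n$, and $j\mapsto j$ otherwise, and let $\ell(w)$ be the least $k$ such that $w$ is a product of $k$ elements of $\{s_0,\dots,s_{n-1}\}$. Let $\tau_n(i)=n+1-i$ for $i\in\mathbb Z$, and let $w^*=\tau_n w\tau_n$ for $w\in\tilde S_n$. Let $\Omega_n$ (respectively $\Omega_n'$) be the set of involutions, i.e. $w^2=1$ (respectively $*$-twisted involutions, i.e. $w^{-1}=w^*$, equivalently $(\tau_nw)^2=1$) in $\tilde S_n$ that are minimal length $(S_n,S_n)$-double coset representatives, where $S_n=\langle s_1,\dots,s_{n-1}\rangle$; that is, that satisfy $\ell(s_iw)=\ell(ws_i)=\ell(w)+1$ for all $i\in[n-1]$. For $w\in\tilde S_n$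 let $\lambda(w)=(\lambda_1(w),\dots,\lambda_n(w))$ with $\lambda_i(w)=\lfloor (w(i)-1)/n\rfloor$. For an integer sequence $a=(a_1,\dots,a_n)$ let $b_1<b_2<\dots<b_m=n$ be the final positions of the maximal blocks of contiguous equal entries of $a$, let $b_0=0$, and for $i\in[m]$ let $I_i=\{b_{i-1}+1,\dots,b_i\}$, let $J_i=\{n+1-t: t\in I_i\}$, and let $v_i$ be the common value of $a_t$ for $t\in I_i$. Let $w_a:\mathbb Z\to\mathbb Z$ be the unique map that restricts to an order-preserving bijection $nk+I_i\to n(k+v_i)+J_i$ for all $i\in[m]$ and $k\in\mathbb Z$; it is a permutation of $\mathbb Z$. Theorem. The maps $w\mapsto\lambda(w)$ and $a\mapsto w_a$ are inverse bijections between the following sets: (i) $\Omega_n'$ and the set of weakly increasing sequences of $n$ integers whose terms sum to zero; (ii) $\Omega_n$ and the set of weakly increasing sequences $a$ of $n$ integers that are antisymmetric, i.e. satisfy $a_i+a_{n+1-i}=0$ for all $i\in[n]$. -/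

import Mathlib

/-- A sum of an `n`-periodic function over `[n] = {1, …, n}` does not change under a permutation
of `ℤ` that commutes with the shift by `n`. -/
theorem sum_Icc_comp_of_periodic (n : ℕ) (f : ℤ → ℤ) (hf : ∀ i, f (i + n) = f i)
    (w : Equiv.Perm ℤ) (hw : ∀ i, w (i + n) = w i + n) :
    ∑ i ∈ Finset.Icc (1 : ℤ) n, f (w i) = ∑ i ∈ Finset.Icc (1 : ℤ) n, f i := by
  rcases Nat.eq_zero_or_pos n with rfl | hn
  · simp
  have hn' : (0 : ℤ) < n := by exact_mod_cast hn
  have hfm : ∀ (m i : ℤ), f (i + n * m) = f i := by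
    intro m
    induction m using Int.induction_on with
    | zero => simp
    | succ k ih => intro i; rw [mul_add, mul_one, ← add_assoc, hf, ih]
    | pred k ih => intro i; rw [← ih i, ← hf]; congr 1; ring
  have hwm : ∀ (m i : ℤ), w (i + n * m) = w i + n * m := by
    intro m
    induction m using Int.induction_on with
    | zero => simp
    | succ k ih => intro i; rw [mul_add, mul_one, ← add_assoc, hw, ih]; ring
    | pred k ih =>
      intro i
      have h1 := hw (i + n * (-(k : ℤ) - 1))
      rw [show i + n * (-(k : ℤ) - 1) + n = i + n * (-(k : ℤ)) by ring, ih] at h1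
      linarith
  have hvm : ∀ (m i : ℤ), w.symm (i + n * m) = w.symm i + n * m := by
    intro m i
    rw [Equiv.symm_apply_eq, hwm, Equiv.apply_symm_apply]
  have red : ∀ x : ℤ, (x - 1) % n + 1 = x + n * (-((x - 1) / n)) := by
    intro x
    have := Int.emod_add_mul_ediv (x - 1) n
    linarith
  have mem : ∀ x : ℤ, (x - 1) % n + 1 ∈ Finset.Icc (1 : ℤ) n := by
    intro x
    have h1 := Int.emod_nonneg (x - 1) hn'.ne'
    have h2 := Int.emod_lt_of_pos (x - 1) hn'
    rw [Finset.mem_Icc]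
    omega
  have back : ∀ i ∈ Finset.Icc (1 : ℤ) n, ∀ m : ℤ, (i + n * m - 1) % n + 1 = i := by
    intro i hi m
    rw [Finset.mem_Icc] at hi
    rw [show i + n * m - 1 = (i - 1) + n * m by ring, Int.add_mul_emod_self_left,
      Int.emod_eq_of_lt (by omega) (by omega)]
    ring
  refine Finset.sum_bij' (fun i _ => (w i - 1) % n + 1) (fun i _ => (w.symm i - 1) % n + 1)
    (fun i _ => mem _) (fun i _ => mem _) ?_ ?_ ?_
  · intro i hi
    rw [red (w i), hvm, Equiv.symm_apply_apply, back i hi]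
  · intro i hi
    rw [red (w.symm i), hwm, Equiv.apply_symm_apply, back i hi]
  · intro i hi
    rw [red (w i), hfm]

/-- The affine symmetric group of rank `n`: the bijections `w : ℤ → ℤ` with
`w (i + n) = w i + n` for all `i` and `∑ i ∈ [n], w i = ∑ i ∈ [n], i`. -/
def affineSymmetricGroup (n : ℕ) : Subgroup (Equiv.Perm ℤ) where
  carrier := {w | (∀ i : ℤ, w (i + n) = w i + n) ∧
    ∑ i ∈ Finset.Icc (1 : ℤ) n, w i = ∑ i ∈ Finset.Icc (1 : ℤ) n, i}
  one_mem' := by simp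
  mul_mem' := by
    rintro v w ⟨hv, hvs⟩ ⟨hw, hws⟩
    refine ⟨fun i => by simp [hv, hw], ?_⟩
    have h := sum_Icc_comp_of_periodic n (fun i => v i - i) (fun i => by simp [hv]) w hw
    simp only [Finset.sum_sub_distrib] at h
    simp only [Equiv.Perm.mul_apply]
    linarith
  inv_mem' := by
    rintro w ⟨hw, hws⟩
    have hwv : ∀ i : ℤ, w (w⁻¹ i) = i := fun i => w.apply_symm_apply i
    have hv : ∀ i : ℤ, w⁻¹ (i + n) = w⁻¹ i + n := by
      intro i
      rw [Equiv.Perm.inv_eq_iff_eq, hw, hwv]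
    refine ⟨hv, ?_⟩
    have h := sum_Icc_comp_of_periodic n (fun i => w i - i) (fun i => by simp [hw]) w⁻¹ hv
    simp only [Finset.sum_sub_distrib, hwv] at h
    linarith

/-- The map `j ↦ j + 1` if `j ≡ i (mod n)`, `j ↦ j - 1` if `j ≡ i + 1 (mod n)`, and `j ↦ j`
otherwise. -/
def simpleMap (n : ℕ) (i j : ℤ) : ℤ :=
  if j ≡ i [ZMOD n] then j + 1 else if j ≡ i + 1 [ZMOD n] then j - 1 else j

theorem simpleMap_involutive (n : ℕ) (hn : 2 ≤ n) (i : ℤ) :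
    Function.Involutive (simpleMap n i) := by
  have key : ¬ (n : ℤ) ∣ 1 := by
    intro h
    have := Int.le_of_dvd one_pos h
    omega
  intro j
  unfold simpleMap
  simp only [Int.modEq_iff_dvd]
  by_cases h1 : (n : ℤ) ∣ i - j
  · have h2 : ¬ (n : ℤ) ∣ i - (j + 1) := by
      intro h; exact key (by simpa using dvd_sub h1 h)
    have h3 : (n : ℤ) ∣ i + 1 - (j + 1) := by simpa using h1
    rw [if_pos h1, if_neg h2, if_pos h3]; ring
  · by_cases h2 : (n : ℤ) ∣ i + 1 - j
    · have h3 : (n : ℤ) ∣ i - (j - 1) := by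
        rwa [show i - (j - 1) = i + 1 - j by ring]
      rw [if_neg h1, if_pos h2, if_pos h3]; ring
    · rw [if_neg h1, if_neg h2, if_neg h1, if_neg h2]

/-- The simple generator `s_i` of the affine symmetric group. -/
def simpleReflection (n : ℕ) (hn : 2 ≤ n) (i : ℕ) : Equiv.Perm ℤ :=
  (simpleMap_involutive n hn i).toPerm

/-- The Coxeter length `ℓ(w)` of `w ∈ affineSymmetricGroup n`: the least `k` such that `w` is a
product of `k` of the simple generators `s_0, s_1, …, s_{n-1}`. -/
noncomputable def affineLength (n : ℕ) (hn : 2 ≤ n) (w : Equiv.Perm ℤ) : ℕ :=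
  sInf {k | ∃ l : List ℕ, l.length = k ∧ (∀ i ∈ l, i < n) ∧
    (l.map (simpleReflection n hn)).prod = w}

/-- The reflection `τ_n : i ↦ n + 1 - i` of `ℤ`. -/
def tauPerm (n : ℕ) : Equiv.Perm ℤ := Equiv.subLeft ((n : ℤ) + 1)

/-- `w` is a minimal length `(S_n, S_n)`-double coset representative:
`ℓ(s_i w) = ℓ(w s_i) = ℓ(w) + 1` for all `i ∈ [n-1]`. -/
def IsMinimalRep (n : ℕ) (hn : 2 ≤ n) (w : Equiv.Perm ℤ) : Prop :=
  ∀ i : ℕ, 1 ≤ i → i ≤ n - 1 →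
    affineLength n hn (simpleReflection n hn i * w) = affineLength n hn w + 1 ∧
    affineLength n hn (w * simpleReflection n hn i) = affineLength n hn w + 1

/-- `Ω_n`: the involutions in the affine symmetric group that are minimal length double coset
representatives. -/
def Omega (n : ℕ) (hn : 2 ≤ n) : Set (Equiv.Perm ℤ) :=
  {w | w ∈ affineSymmetricGroup n ∧ w ^ 2 = 1 ∧ IsMinimalRep n hn w}

/-- `Ω'_n`: the elements `w` of the affine symmetric group with `(τ_n w)² = 1`, that is,
`w⁻¹ = τ_n w τ_n`, that are minimal length double coset representatives. -/
def OmegaTwisted (n : ℕ) (hn : 2 ≤ n) : Set (Equiv.Perm ℤ) :=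
  {w | w ∈ affineSymmetricGroup n ∧ (tauPerm n * w) ^ 2 = 1 ∧ IsMinimalRep n hn w}

/-- `λ(w) = (λ_1(w), …, λ_n(w))` with `λ_i(w) = ⌊(w(i) - 1) / n⌋` (integer division by a positive
integer rounds down). The position `i ∈ [n]` is the element `i - 1` of `Fin n`. -/
def lam (n : ℕ) (w : Equiv.Perm ℤ) : Fin n → ℤ :=
  fun p => (w ((p : ℤ) + 1) - 1) / n

/-- The set `{b_1 < b_2 < … < b_m} ⊆ [n]` of final positions of the maximal blocks of contiguous
equal entries of `a = (a_1, …, a_n)`. -/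
def blockEnds {n : ℕ} (a : Fin n → ℤ) : Finset ℕ :=
  ((Finset.univ : Finset (Fin n)).filter
    (fun p : Fin n => ∀ q : Fin n, (q : ℕ) = (p : ℕ) + 1 → a p ≠ a q)).image
      (fun p : Fin n => (p : ℕ) + 1)

/-- For a position `t ∈ I_i = {b_{i-1} + 1, …, b_i}`, the number `b_{i-1}` (where `b_0 = 0`, the
supremum of the empty set). -/
def blockLower {n : ℕ} (a : Fin n → ℤ) (t : ℕ) : ℕ :=
  ((blockEnds a).filter (fun b => b < t)).sup id

/-- For a position `t ∈ I_i = {b_{i-1} + 1, …, b_i}`, the number `b_i`. -/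
noncomputable def blockUpper {n : ℕ} (a : Fin n → ℤ) (t : ℕ) : ℕ :=
  sInf {b | b ∈ blockEnds a ∧ t ≤ b}

theorem blockLower_lt {n : ℕ} (a : Fin n → ℤ) {t : ℕ} (ht : 1 ≤ t) : blockLower a t < t := by
  unfold blockLower
  rw [Finset.sup_lt_iff (show (⊥ : ℕ) < t from ht)]
  intro b hb
  exact (Finset.mem_filter.1 hb).2

theorem blockUpper_spec {n : ℕ} (a : Fin n → ℤ) {t : ℕ} (h1 : 1 ≤ t) (h2 : t ≤ n) :
    blockUpper a t ∈ blockEnds a ∧ t ≤ blockUpper a t ∧ blockUpper a t ≤ n := by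
  have hne : {b | b ∈ blockEnds a ∧ t ≤ b}.Nonempty := by
    refine ⟨n, ?_, h2⟩
    simp only [blockEnds, Finset.mem_image, Finset.mem_filter, Finset.mem_univ, true_and]
    refine ⟨⟨n - 1, by omega⟩, ?_, by simp only; omega⟩
    intro q hq
    have := q.2
    simp only at hq
    omega
  have h := Nat.sInf_mem hne
  refine ⟨h.1, h.2, ?_⟩
  obtain ⟨p, -, hp⟩ := Finset.mem_image.1 h.1
  have h3 := p.2
  have h4 : (p : ℕ) + 1 = blockUpper a t := hp
  omega

/-- No block ends strictly inside a block. -/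
theorem not_mem_blockEnds {n : ℕ} (a : Fin n → ℤ) {t b : ℕ} (h1 : blockLower a t < b)
    (h2 : b < blockUpper a t) : b ∉ blockEnds a := by
  intro hb
  rcases lt_or_ge b t with h | h
  · have : b ≤ blockLower a t :=
      Finset.le_sup (f := id) (Finset.mem_filter.2 ⟨hb, h⟩)
    omega
  · have : blockUpper a t ≤ b := Nat.sInf_le ⟨hb, h⟩
    omega

theorem block_congr {n : ℕ} (a : Fin n → ℤ) {t u : ℕ} (ht1 : 1 ≤ t) (ht2 : t ≤ n)
    (h1 : blockLower a t < u) (h2 : u ≤ blockUpper a t) :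
    blockLower a u = blockLower a t ∧ blockUpper a u = blockUpper a t := by
  have hU := blockUpper_spec a ht1 ht2
  have hu := blockUpper_spec a (t := u) (by omega) (by omega)
  constructor
  · apply le_antisymm
    · refine Finset.sup_le fun b hb => ?_
      obtain ⟨hb1, hb2⟩ := Finset.mem_filter.1 hb
      by_contra hlt
      exact not_mem_blockEnds a (t := t) (by simpa using hlt) (by omega) hb1
    · refine Finset.sup_le fun b hb => ?_
      obtain ⟨hb1, hb2⟩ := Finset.mem_filter.1 hb
      have hbl : b ≤ blockLower a t := Finset.le_sup (f := id) hb
      exact Finset.le_sup (f := id) (Finset.mem_filter.2 ⟨hb1, by omega⟩)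
  · apply le_antisymm
    · exact Nat.sInf_le ⟨hU.1, h2⟩
    · by_contra hlt
      exact not_mem_blockEnds a (t := t) (by omega) (not_le.1 hlt) hu.1

/-- The entries of `a` are constant on each block. -/
theorem block_value {n : ℕ} (a : Fin n → ℤ) {t : ℕ} :
    ∀ p q : Fin n, blockLower a t ≤ p → (p : ℕ) < blockUpper a t →
      blockLower a t ≤ q → (q : ℕ) < blockUpper a t → a p = a q := by
  have step : ∀ (d : ℕ) (p q : Fin n), (q : ℕ) = p + d → blockLower a t ≤ p →
      (q : ℕ) < blockUpper a t → a p = a q := by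
    intro d
    induction d with
    | zero => intro p q h _ _; congr 1; exact Fin.ext (by omega)
    | succ d ih =>
      intro p q h hp hq
      have hpn : (p : ℕ) + d < n := by have := q.2; omega
      rw [ih p ⟨p + d, hpn⟩ rfl hp (by simp only; omega)]
      by_contra hne
      refine not_mem_blockEnds a (t := t) (b := p + d + 1) (by omega) (by omega) ?_
      simp only [blockEnds, Finset.mem_image, Finset.mem_filter, Finset.mem_univ, true_and]
      refine ⟨⟨p + d, hpn⟩, fun r hr => ?_, rfl⟩
      have : r = q := Fin.ext (by simp only at hr; omega)
      rwa [this]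
  intro p q hp1 hp2 hq1 hq2
  rcases le_total (p : ℕ) q with h | h
  · exact step (q - p) p q (by omega) hp1 hq2
  · exact (step (p - q) q p (by omega) hq1 hp2).symm

/-- The value of `w_a` at `n k + t` for the position `t = p + 1 ∈ [n]`. If `t` lies in
`I_i = {b_{i-1} + 1, …, b_i}`, then `J_i = n + 1 - I_i = {n + 1 - b_i, …, n - b_{i-1}}`, and the
order-preserving bijection `n k + I_i → n (k + v_i) + J_i` of integer intervals is
`n k + t ↦ n (k + v_i) + (t + n - b_{i-1} - b_i)`, where `v_i = a_t`. -/
noncomputable def blockMapAux {n : ℕ} (a : Fin n → ℤ) (k : ℤ) (p : Fin n) : ℤ :=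
  n * (k + a p) + (((p : ℕ) + 1 : ℕ) + n - blockLower a (p + 1) - blockUpper a (p + 1))

/-- The map `w_a : ℤ → ℤ`, the unique one that restricts to an order-preserving bijection
`n k + I_i → n (k + v_i) + J_i` for each `k ∈ ℤ` and each block `I_i` of equal entries `v_i`
of `a`. An integer `x` is written as `n k + t` with `t ∈ [n]`. -/
noncomputable def blockMap {n : ℕ} (hn : 2 ≤ n) (a : Fin n → ℤ) (x : ℤ) : ℤ :=
  blockMapAux a ((x - 1) / n) ⟨((x - 1) % n).toNat, by
    have h1 := Int.emod_nonneg (x - 1) (show (n : ℤ) ≠ 0 by omega)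
    have h2 := Int.emod_lt_of_pos (x - 1) (show (0 : ℤ) < n by omega)
    omega⟩

theorem blockMap_apply {n : ℕ} (hn : 2 ≤ n) (a : Fin n → ℤ) (k : ℤ) (p : Fin n) :
    blockMap hn a (n * k + ((p : ℕ) + 1 : ℕ)) = blockMapAux a k p := by
  have hp : ((p : ℕ) : ℤ) < n := by exact_mod_cast p.2
  have hn0 : (n : ℤ) ≠ 0 := by omega
  have e : (n : ℤ) * k + ((p : ℕ) + 1 : ℕ) - 1 = (p : ℕ) + n * k := by push_cast; ring
  have h1 : ((p : ℕ) + n * k : ℤ) / n = k := by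
    rw [Int.add_mul_ediv_left _ _ hn0, Int.ediv_eq_zero_of_lt (by positivity) hp, zero_add]
  have h2 : ((p : ℕ) + n * k : ℤ) % n = (p : ℕ) := by
    rw [Int.add_mul_emod_self_left, Int.emod_eq_of_lt (by positivity) hp]
  unfold blockMap
  congr 1
  · rw [e, h1]
  · exact Fin.ext (by simp only [e, h2, Int.toNat_natCast])

/-- `w_a` is order-preserving and bijective from `n k + I_i` to `n (k + v_i) + J_i`, where
`I_i = {b_{i-1} + 1, …, b_i}` is the block containing the position `p + 1`, and
`J_i = n + 1 - I_i`. -/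
theorem blockMap_spec {n : ℕ} (hn : 2 ≤ n) (a : Fin n → ℤ) (k : ℤ) (p : Fin n) :
    let I : Set ℤ := Set.Ioc (blockLower a (p + 1) : ℤ) (blockUpper a (p + 1))
    let J : Set ℤ := (fun t => (n : ℤ) + 1 - t) '' I
    StrictMonoOn (blockMap hn a) ((fun t => n * k + t) '' I) ∧
      Set.BijOn (blockMap hn a) ((fun t => n * k + t) '' I) ((fun t => n * (k + a p) + t) '' J) := by
  intro I J
  have ht1 : 1 ≤ (p : ℕ) + 1 := by omega
  have ht2 : (p : ℕ) + 1 ≤ n := p.2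
  have hL := blockLower_lt a ht1
  have hU := blockUpper_spec a ht1 ht2
  have val : ∀ t ∈ I, blockMap hn a (n * k + t) = n * (k + a p) +
      (t + n - blockLower a (p + 1) - blockUpper a (p + 1)) := by
    rintro t ⟨h1, h2⟩
    obtain ⟨u, rfl⟩ : ∃ u : ℕ, t = ((u + 1 : ℕ) : ℤ) := ⟨(t - 1).toNat, by omega⟩
    have hu : u < n := by omega
    have h := blockMap_apply hn a k ⟨u, hu⟩
    simp only at h
    rw [h]
    obtain ⟨c1, c2⟩ := block_congr a ht1 ht2 (u := u + 1) (by omega) (by omega)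
    have hv : a ⟨u, hu⟩ = a p :=
      block_value a (t := p + 1) _ _ (by simp only; omega) (by simp only; omega) (by omega) (by omega)
    simp only [blockMapAux, c1, c2, hv]
  have mono : StrictMonoOn (blockMap hn a) ((fun t => n * k + t) '' I) := by
    rintro _ ⟨s, hs, rfl⟩ _ ⟨t, ht, rfl⟩ hst
    simp only at hst ⊢
    rw [val s hs, val t ht]
    linarith
  refine ⟨mono, ?_, mono.injOn, ?_⟩
  · rintro _ ⟨t, ht, rfl⟩
    simp only
    rw [val t ht]
    refine ⟨_, ⟨blockLower a (p + 1) + blockUpper a (p + 1) + 1 - t, ?_, rfl⟩, ?_⟩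
    · obtain ⟨h1, h2⟩ := ht
      exact ⟨by omega, by omega⟩
    · simp only; ring
  · rintro _ ⟨_, ⟨t, ht, rfl⟩, rfl⟩
    have ht' : (blockLower a (p + 1) + blockUpper a (p + 1) + 1 - t : ℤ) ∈ I := by
      obtain ⟨h1, h2⟩ := ht
      exact ⟨by omega, by omega⟩
    refine ⟨_, ⟨_, ht', rfl⟩, ?_⟩
    simp only
    rw [val _ ht']
    ring

theorem tau_blockMap_involutive {n : ℕ} (hn : 2 ≤ n) (a : Fin n → ℤ) :
    Function.Involutive (fun x => (n : ℤ) + 1 - blockMap hn a x) := by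
  have hn0 : (0 : ℤ) < n := by omega
  intro x
  obtain ⟨k, p, rfl⟩ : ∃ (k : ℤ) (p : Fin n), x = n * k + ((p : ℕ) + 1 : ℕ) := by
    have h1 := Int.emod_nonneg (x - 1) hn0.ne'
    have h2 := Int.emod_lt_of_pos (x - 1) hn0
    refine ⟨(x - 1) / n, ⟨((x - 1) % n).toNat, by omega⟩, ?_⟩
    have := Int.emod_add_mul_ediv (x - 1) n
    simp only
    push_cast
    rw [Int.toNat_of_nonneg h1]
    linarith
  have ht1 : 1 ≤ (p : ℕ) + 1 := by omega
  have ht2 : (p : ℕ) + 1 ≤ n := p.2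
  have hL := blockLower_lt a ht1
  have hU := blockUpper_spec a ht1 ht2
  obtain ⟨u, hu⟩ : ∃ u : ℕ, u + (p + 1) = blockLower a (p + 1) + blockUpper a (p + 1) :=
    ⟨blockLower a (p + 1) + blockUpper a (p + 1) - (p + 1), by omega⟩
  have hun : u < n := by omega
  obtain ⟨c1, c2⟩ := block_congr a ht1 ht2 (u := u + 1) (by omega) (by omega)
  have hv : a ⟨u, hun⟩ = a p :=
    block_value a (t := p + 1) _ _ (by simp only; omega) (by simp only; omega) (by omega) (by omega)
  have hu' : (u : ℤ) + ((p : ℕ) + 1) = blockLower a (p + 1) + blockUpper a (p + 1) := by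
    exact_mod_cast hu
  have e : (n : ℤ) + 1 - blockMapAux a k p =
      n * (-(k + a p)) + (((⟨u, hun⟩ : Fin n) : ℕ) + 1 : ℕ) := by
    simp only [blockMapAux]
    push_cast
    linarith
  simp only
  rw [blockMap_apply, e, blockMap_apply]
  simp only [blockMapAux, c1, c2, hv]
  push_cast
  linarith

/-- `w_a` as a permutation of `ℤ`. -/
noncomputable def blockPerm {n : ℕ} (hn : 2 ≤ n) (a : Fin n → ℤ) : Equiv.Perm ℤ where
  toFun := blockMap hn a
  invFun := fun x => (n : ℤ) + 1 - blockMap hn a ((n : ℤ) + 1 - x)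
  left_inv := tau_blockMap_involutive hn a
  right_inv := fun x => by
    have h := tau_blockMap_involutive hn a ((n : ℤ) + 1 - x)
    simp only at h
    linarith

/-- `a = (a_1, …, a_n)` is antisymmetric: `a_i + a_{n+1-i} = 0` for all `i ∈ [n]`. -/
def IsAntisymmSeq {n : ℕ} (a : Fin n → ℤ) : Prop :=
  ∀ p : Fin n, a p + a p.rev = 0

/-!
The length of `w` is its number of inversions (`two_mul_affineLength`), because multiplication by a
simple reflection changes the inversion number by one, upwards exactly at an ascent, and only the
identity has no descents. Hence `w` is a minimal double coset representative if and only if `w` and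
`w⁻¹` are increasing on `[n]` (`isMinimalRep_iff`). For twisted involutions `w⁻¹ = τ_n w τ_n`, and
for involutions `w⁻¹ = w`, so it is enough that `w` is increasing on `[n]`.

Write `w t = n λ_t + u_t` with `t, u_t ∈ [n]`. Since the `u_t` are a permutation of `[n]`, the sum
condition on `w` says that the `λ_t` sum to zero (`mem_affineSymmetricGroup_iff`), and if `w` is
increasing on `[n]` then `λ` is weakly increasing, so its level sets are the blocks `I_i`. The
identity `λ(w_a) = a` is immediate, since `w_a` sends `I_i` to `n v_i + J_i`. Conversely, both kinds
of involution satisfy `λ(n + 1 - u_t) = λ(t)`. Thus `t ↦ n + 1 - u_t` is a strictly decreasing map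
of each block into itself, so it is the reflection of the block, and this is the rule that defines
`w_λ` (`blockPerm_lam_of_residue`).

For an involution `λ` is antisymmetric: `t ↦ u_t` exchanges the level sets of `v` and `-v`, so `λ`
and its negated reversal are weakly increasing rearrangements of each other. For antisymmetric `a`
the inverse of `w_a` is a twisted involution with the same sequence of quotients as `w_a`, so it
equals `w_a` by the twisted case.
-/

/-! ### Permutations commuting with the shift by `n` -/

theorem perm_apply_add_mul {n : ℕ} {w : Equiv.Perm ℤ} (hw : ∀ i, w (i + n) = w i + n)
    (i m : ℤ) : w (i + n * m) = w i + n * m := by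
  induction m using Int.induction_on with
  | zero => simp
  | succ k ih => rw [mul_add, mul_one, ← add_assoc, hw, ih]; ring
  | pred k ih =>
    have h1 := hw (i + n * (-(k : ℤ) - 1))
    rw [show i + n * (-(k : ℤ) - 1) + n = i + n * (-(k : ℤ)) by ring, ih] at h1
    linarith

theorem exists_eq_mul_add_index {n : ℕ} (hn : 0 < n) (x : ℤ) :
    ∃ (k : ℤ) (p : Fin n), x = n * k + ((p : ℕ) + 1 : ℕ) := by
  have hn0 : (0 : ℤ) < n := by omega
  have h1 := Int.emod_nonneg (x - 1) hn0.ne'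
  have h2 := Int.emod_lt_of_pos (x - 1) hn0
  refine ⟨(x - 1) / n, ⟨((x - 1) % n).toNat, by omega⟩, ?_⟩
  have := Int.emod_add_mul_ediv (x - 1) n
  simp only
  push_cast
  rw [Int.toNat_of_nonneg h1]
  linarith

theorem sum_Icc_eq_sum_fin (n : ℕ) (f : ℤ → ℤ) :
    ∑ i ∈ Finset.Icc (1 : ℤ) n, f i = ∑ p : Fin n, f ((p : ℤ) + 1) := by
  symm
  refine Finset.sum_bij (fun p _ => (p : ℤ) + 1) ?_ ?_ ?_ ?_
  · intro p _
    have := p.2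
    rw [Finset.mem_Icc]
    omega
  · intro p _ q _ h
    exact Fin.ext (by omega)
  · intro i hi
    rw [Finset.mem_Icc] at hi
    exact ⟨⟨(i - 1).toNat, by omega⟩, Finset.mem_univ _, by simp only; omega⟩
  · intro p _
    rfl

theorem not_natCast_dvd_one {n : ℕ} (hn : 2 ≤ n) : ¬ (n : ℤ) ∣ 1 := by
  intro h
  have := Int.le_of_dvd one_pos h
  omega

theorem not_modEq_succ {n : ℕ} (hn : 2 ≤ n) {x k : ℤ} (h : x ≡ k [ZMOD n]) :
    ¬ x ≡ k + 1 [ZMOD n] := fun h' =>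
  not_natCast_dvd_one hn (by simpa using Int.modEq_iff_dvd.1 (h.symm.trans h'))

theorem not_dvd_apply_succ_sub {n : ℕ} (hn : 2 ≤ n) {w : Equiv.Perm ℤ}
    (hw : ∀ i, w (i + n) = w i + n) (k : ℤ) : ¬ (n : ℤ) ∣ w (k + 1) - w k := by
  rintro ⟨m, hm⟩
  have h : w (k + 1) = w (k + n * m) := by
    rw [perm_apply_add_mul hw]; linarith
  have h2 := w.injective h
  exact not_natCast_dvd_one hn ⟨m, by linarith⟩

/-! ### The simple reflections -/

theorem simpleReflection_apply_left {n : ℕ} (hn : 2 ≤ n) (k : ℕ) {x : ℤ}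
    (h : x ≡ k [ZMOD n]) : simpleReflection n hn k x = x + 1 := by
  change simpleMap n k x = x + 1
  rw [simpleMap, if_pos h]

theorem simpleReflection_apply_right {n : ℕ} (hn : 2 ≤ n) (k : ℕ) {x : ℤ}
    (h : x ≡ k + 1 [ZMOD n]) : simpleReflection n hn k x = x - 1 := by
  change simpleMap n k x = x - 1
  rw [simpleMap, if_neg fun h' => not_modEq_succ hn h' h, if_pos h]

theorem simpleReflection_apply_of_ne {n : ℕ} (hn : 2 ≤ n) (k : ℕ) {x : ℤ}
    (h : ¬ x ≡ k [ZMOD n]) (h' : ¬ x ≡ k + 1 [ZMOD n]) : simpleReflection n hn k x = x := by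
  change simpleMap n k x = x
  rw [simpleMap, if_neg h, if_neg h']

theorem simpleReflection_apply_apply {n : ℕ} (hn : 2 ≤ n) (k : ℕ) (x : ℤ) :
    simpleReflection n hn k (simpleReflection n hn k x) = x :=
  simpleMap_involutive n hn k x

theorem simpleReflection_mul_self {n : ℕ} (hn : 2 ≤ n) (k : ℕ) :
    simpleReflection n hn k * simpleReflection n hn k = 1 :=
  Equiv.ext (simpleReflection_apply_apply hn k)

theorem simpleReflection_inv {n : ℕ} (hn : 2 ≤ n) (k : ℕ) :
    (simpleReflection n hn k)⁻¹ = simpleReflection n hn k :=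
  inv_eq_of_mul_eq_one_left (simpleReflection_mul_self hn k)

theorem simpleReflection_add {n : ℕ} (hn : 2 ≤ n) (k : ℕ) (x : ℤ) :
    simpleReflection n hn k (x + n) = simpleReflection n hn k x + n := by
  have e : x + n ≡ x [ZMOD n] := by simp [Int.modEq_iff_dvd]
  by_cases h : x ≡ k [ZMOD n]
  · rw [simpleReflection_apply_left hn k h, simpleReflection_apply_left hn k (e.trans h)]
    ring
  by_cases h' : x ≡ k + 1 [ZMOD n]
  · rw [simpleReflection_apply_right hn k h', simpleReflection_apply_right hn k (e.trans h')]
    ring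
  · rw [simpleReflection_apply_of_ne hn k h h', simpleReflection_apply_of_ne hn k
      (fun c => h (e.symm.trans c)) (fun c => h' (e.symm.trans c))]

theorem sum_Icc_ite_modEq {n : ℕ} (hn : 0 < n) (k c : ℤ) :
    ∑ i ∈ Finset.Icc (1 : ℤ) n, (if i ≡ k [ZMOD n] then c else 0) = c := by
  obtain ⟨m, p, hk⟩ := exists_eq_mul_add_index hn k
  have hp := p.2
  rw [Finset.sum_eq_single (((p : ℕ) + 1 : ℕ) : ℤ), if_pos]
  · rw [Int.modEq_iff_dvd]
    exact ⟨m, by rw [hk]; ring⟩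
  · intro i hi hne
    rw [if_neg]
    intro h
    rw [Int.modEq_iff_dvd, hk] at h
    apply hne
    rw [Finset.mem_Icc] at hi
    have h2 : (n : ℤ) ∣ ((p : ℕ) + 1 : ℕ) - i := by
      obtain ⟨c, hc⟩ := h
      exact ⟨c - m, by linarith⟩
    have h3 := Int.eq_zero_of_abs_lt_dvd h2 (by rw [abs_lt]; constructor <;> omega)
    omega
  · intro h
    exact absurd (Finset.mem_Icc.2 ⟨by omega, by omega⟩) h

theorem simpleReflection_mem {n : ℕ} (hn : 2 ≤ n) (k : ℕ) :
    simpleReflection n hn k ∈ affineSymmetricGroup n := by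
  refine ⟨simpleReflection_add hn k, ?_⟩
  have key : ∀ i : ℤ, simpleReflection n hn k i = i + ((if i ≡ k [ZMOD n] then 1 else 0) +
      (if i ≡ k + 1 [ZMOD n] then -1 else 0)) := by
    intro i
    by_cases h : i ≡ k [ZMOD n]
    · rw [simpleReflection_apply_left hn k h, if_pos h, if_neg (not_modEq_succ hn h)]; ring
    by_cases h' : i ≡ k + 1 [ZMOD n]
    · rw [simpleReflection_apply_right hn k h', if_neg h, if_pos h']; ring
    · rw [simpleReflection_apply_of_ne hn k h h', if_neg h, if_neg h']; ring
  simp only [key, Finset.sum_add_distrib]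
  rw [sum_Icc_ite_modEq (by omega), sum_Icc_ite_modEq (by omega)]
  ring

/-! ### Length and inversions -/

/-- Twice the number of inversions of `w`, the pairs `i < j` with `w i > w j` being counted modulo
simultaneous shifts by `n`. The summand counts the inversions between the residue classes of
`i` and `j`; it depends only on these classes, which is why the sum runs over ordered pairs and each
inversion is counted twice. -/
noncomputable def inversionSum (n : ℕ) (w : Equiv.Perm ℤ) : ℤ :=
  ∑ i ∈ Finset.Icc (1 : ℤ) n, ∑ j ∈ Finset.Icc (1 : ℤ) n, |(w j - w i) / n - (j - i) / n|

theorem inversionSum_nonneg (n : ℕ) (w : Equiv.Perm ℤ) : 0 ≤ inversionSum n w :=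
  Finset.sum_nonneg fun _ _ => Finset.sum_nonneg fun _ _ => abs_nonneg _

theorem inversionSum_one (n : ℕ) : inversionSum n 1 = 0 := by
  simp [inversionSum]

/-- Reindexing both sums by the involution `s_k` moves it from the values of `w` to the positions,
so that `inversionSum n (w s_k)` and `inversionSum n w` can be compared term by term. -/
theorem inversionSum_mul_simpleReflection_eq {n : ℕ} (hn : 2 ≤ n) {w : Equiv.Perm ℤ}
    (hw : ∀ i, w (i + n) = w i + n) (k : ℕ) :
    inversionSum n (w * simpleReflection n hn k) =
      ∑ i ∈ Finset.Icc (1 : ℤ) n, ∑ j ∈ Finset.Icc (1 : ℤ) n,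
        |(w j - w i) / n - (simpleReflection n hn k j - simpleReflection n hn k i) / n| := by
  set s := simpleReflection n hn k with hs
  have hsadd : ∀ x, s (x + n) = s x + n := simpleReflection_add hn k
  have hss : ∀ x, s (s x) = x := simpleReflection_apply_apply hn k
  have hn0 : (n : ℤ) ≠ 0 := by omega
  have shift : ∀ x : ℤ, (x + n) / (n : ℤ) = x / n + 1 := fun x => Int.add_ediv_of_dvd_right
    (dvd_refl _) |>.trans (by rw [Int.ediv_self hn0])
  have shift' : ∀ x : ℤ, (x - n) / (n : ℤ) = x / n - 1 := fun x => by
    have := shift (x - n)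
    rw [sub_add_cancel] at this
    linarith
  have inner : ∀ i : ℤ, ∑ j ∈ Finset.Icc (1 : ℤ) n, |(w (s j) - w (s i)) / n - (j - i) / n| =
      ∑ j ∈ Finset.Icc (1 : ℤ) n, |(w j - w (s i)) / n - (s j - i) / n| := by
    intro i
    have h := sum_Icc_comp_of_periodic n (fun j => |(w j - w (s i)) / n - (s j - i) / n|)
      (fun j => by
        rw [hw, hsadd, add_sub_right_comm, add_sub_right_comm, shift, shift,
          add_sub_add_right_eq_sub]) s hsadd
    simpa only [hss] using h
  have outer := sum_Icc_comp_of_periodic n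
    (fun i => ∑ j ∈ Finset.Icc (1 : ℤ) n, |(w j - w i) / n - (s j - s i) / n|)
    (fun i => by
      simp only [hw, hsadd, ← sub_sub, shift', sub_sub_sub_cancel_right]) s hsadd
  simp only [hss] at outer
  rw [← outer]
  simp only [inversionSum, Equiv.Perm.mul_apply]
  exact Finset.sum_congr rfl fun i _ => inner i

theorem sub_one_ediv_of_not_dvd {n : ℕ} (hn : 0 < n) {x : ℤ} (h : ¬ (n : ℤ) ∣ x) :
    (x - 1) / (n : ℤ) = x / n := by
  have hn0 : (0 : ℤ) < n := by omega
  have h1 := Int.emod_add_mul_ediv x n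
  have h2 := Int.emod_nonneg x hn0.ne'
  have h3 := Int.emod_lt_of_pos x hn0
  have h4 : x % n ≠ 0 := fun c => h (Int.dvd_of_emod_eq_zero c)
  rw [Int.ediv_eq_iff_of_pos hn0]
  constructor <;> nlinarith [show 1 ≤ x % n by omega]

theorem neg_ediv_of_not_dvd {n : ℕ} (hn : 0 < n) {x : ℤ} (h : ¬ (n : ℤ) ∣ x) :
    -x / (n : ℤ) = - (x / n) - 1 := by
  have hn0 : (0 : ℤ) < n := by omega
  have h1 := Int.emod_add_mul_ediv x n
  have h2 := Int.emod_nonneg x hn0.ne'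
  have h3 := Int.emod_lt_of_pos x hn0
  have h4 : x % n ≠ 0 := fun c => h (Int.dvd_of_emod_eq_zero c)
  rw [Int.ediv_eq_iff_of_pos hn0]
  constructor <;> nlinarith [show 1 ≤ x % n by omega]

/-- `s_k` preserves the relative order of two positions, unless their residue classes are those
of `k` and `k + 1`. -/
theorem simpleReflection_sub_ediv {n : ℕ} (hn : 2 ≤ n) (k : ℕ) {i j : ℤ}
    (h1 : ¬ (i ≡ k [ZMOD n] ∧ j ≡ k + 1 [ZMOD n])) (h2 : ¬ (i ≡ k + 1 [ZMOD n] ∧ j ≡ k [ZMOD n])) :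
    (simpleReflection n hn k j - simpleReflection n hn k i) / (n : ℤ) = (j - i) / n := by
  have hn0 : 0 < n := by omega
  have e : ∀ {x y z : ℤ}, x ≡ z [ZMOD n] → (n : ℤ) ∣ y - x → y ≡ z [ZMOD n] := fun h h' =>
    (Int.modEq_iff_dvd.2 h').symm.trans h
  have e' : ∀ {x y z : ℤ}, y ≡ z [ZMOD n] → (n : ℤ) ∣ y - x → x ≡ z [ZMOD n] := fun h h' =>
    (Int.modEq_iff_dvd.2 h').trans h
  have up : ∀ {x : ℤ}, x ≡ k [ZMOD n] → x + 1 ≡ k + 1 [ZMOD n] := fun h => h.add_right 1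
  have down : ∀ {x : ℤ}, x ≡ k + 1 [ZMOD n] → x - 1 ≡ k [ZMOD n] := fun h => by
    simpa using h.sub_right 1
  have plus : ∀ {x : ℤ}, ¬ (n : ℤ) ∣ x + 1 → (x + 1) / (n : ℤ) = x / n := fun h => by
    have := sub_one_ediv_of_not_dvd hn0 h
    rw [add_sub_cancel_right] at this
    exact this.symm
  by_cases a1 : i ≡ k [ZMOD n]
  · rw [simpleReflection_apply_left hn k a1]
    by_cases b1 : j ≡ k [ZMOD n]
    · rw [simpleReflection_apply_left hn k b1, add_sub_add_right_eq_sub]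
    have b2 : ¬ j ≡ k + 1 [ZMOD n] := fun h => h1 ⟨a1, h⟩
    rw [simpleReflection_apply_of_ne hn k b1 b2, ← sub_sub]
    exact sub_one_ediv_of_not_dvd hn0 fun h => b1 (e a1 h)
  by_cases a2 : i ≡ k + 1 [ZMOD n]
  · rw [simpleReflection_apply_right hn k a2]
    have b1 : ¬ j ≡ k [ZMOD n] := fun h => h2 ⟨a2, h⟩
    by_cases b2 : j ≡ k + 1 [ZMOD n]
    · rw [simpleReflection_apply_right hn k b2, sub_sub_sub_cancel_right]
    rw [simpleReflection_apply_of_ne hn k b1 b2, show j - (i - 1) = j - i + 1 by ring]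
    exact plus fun h => b1 (e (down a2) (by rwa [show j - (i - 1) = j - i + 1 by ring]))
  rw [simpleReflection_apply_of_ne hn k a1 a2]
  by_cases b1 : j ≡ k [ZMOD n]
  · rw [simpleReflection_apply_left hn k b1, show j + 1 - i = j - i + 1 by ring]
    exact plus fun h => a2 (e' (up b1) (by rwa [show j + 1 - i = j - i + 1 by ring]))
  by_cases b2 : j ≡ k + 1 [ZMOD n]
  · rw [simpleReflection_apply_right hn k b2, show j - 1 - i = j - i - 1 by ring]
    exact sub_one_ediv_of_not_dvd hn0 fun h => a2 (e' b2 h)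
  rw [simpleReflection_apply_of_ne hn k b1 b2]

/-- Only the pairs of positions in the classes of `k` and `k + 1` contribute to the change of the
inversion sum under right multiplication by `s_k`. -/
theorem inversionSum_mul_simpleReflection {n : ℕ} (hn : 2 ≤ n) {w : Equiv.Perm ℤ}
    (hw : ∀ i, w (i + n) = w i + n) (k : ℕ) :
    inversionSum n (w * simpleReflection n hn k) = inversionSum n w +
      2 * (|(w (k + 1) - w k) / n + 1| - |(w (k + 1) - w k) / n|) := by
  have hn0 : (n : ℤ) ≠ 0 := by omega
  set f := (w (k + 1) - w k) / (n : ℤ) with hf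
  set c := |f + 1| - |f| with hc
  have hneg : (w k - w (k + 1)) / (n : ℤ) = -f - 1 := by
    have := neg_ediv_of_not_dvd (by omega) (not_dvd_apply_succ_sub hn hw k)
    rwa [neg_sub] at this
  have h1n : (1 : ℤ) / n = 0 := Int.ediv_eq_zero_of_lt (by omega) (by omega)
  have hm1n : (-1 : ℤ) / n = -1 := by
    rw [neg_ediv_of_not_dvd (by omega) (not_natCast_dvd_one hn), h1n]; ring
  have key : ∀ i j : ℤ,
      |(w j - w i) / n - (simpleReflection n hn k j - simpleReflection n hn k i) / n| =
      |(w j - w i) / n - (j - i) / n| +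
        ((if i ≡ k [ZMOD n] then (if j ≡ k + 1 [ZMOD n] then c else 0) else 0) +
          (if i ≡ k + 1 [ZMOD n] then (if j ≡ k [ZMOD n] then c else 0) else 0)) := by
    intro i j
    by_cases h1 : i ≡ k [ZMOD n] ∧ j ≡ k + 1 [ZMOD n]
    · rw [if_pos h1.1, if_pos h1.2, if_neg (not_modEq_succ hn h1.1),
        simpleReflection_apply_left hn k h1.1, simpleReflection_apply_right hn k h1.2]
      obtain ⟨x, hx⟩ := Int.modEq_iff_dvd.1 h1.1.symm
      obtain ⟨y, hy⟩ := Int.modEq_iff_dvd.1 h1.2.symm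
      obtain rfl : i = k + n * x := by linarith
      obtain rfl : j = k + 1 + n * y := by linarith
      rw [perm_apply_add_mul hw, perm_apply_add_mul hw,
        show w (k + 1) + n * y - (w k + n * x) = w (k + 1) - w k + n * (y - x) by ring,
        show (k : ℤ) + 1 + n * y - 1 - (k + n * x + 1) = -1 + n * (y - x) by ring,
        show (k : ℤ) + 1 + n * y - (k + n * x) = 1 + n * (y - x) by ring,
        Int.add_mul_ediv_left _ _ hn0, Int.add_mul_ediv_left _ _ hn0,
        Int.add_mul_ediv_left _ _ hn0, ← hf, h1n, hm1n, hc,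
        show f + (y - x) - (-1 + (y - x)) = f + 1 by ring,
        show f + (y - x) - (0 + (y - x)) = f by ring]
      ring
    by_cases h2 : i ≡ k + 1 [ZMOD n] ∧ j ≡ k [ZMOD n]
    · rw [if_pos h2.1, if_pos h2.2, if_neg (fun h => not_modEq_succ hn h h2.1),
        simpleReflection_apply_right hn k h2.1, simpleReflection_apply_left hn k h2.2]
      obtain ⟨x, hx⟩ := Int.modEq_iff_dvd.1 h2.1.symm
      obtain ⟨y, hy⟩ := Int.modEq_iff_dvd.1 h2.2.symm
      obtain rfl : i = k + 1 + n * x := by linarith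
      obtain rfl : j = k + n * y := by linarith
      rw [perm_apply_add_mul hw, perm_apply_add_mul hw,
        show w k + n * y - (w (k + 1) + n * x) = w k - w (k + 1) + n * (y - x) by ring,
        show (k : ℤ) + n * y + 1 - (k + 1 + n * x - 1) = 1 + n * (y - x) by ring,
        show (k : ℤ) + n * y - (k + 1 + n * x) = -1 + n * (y - x) by ring,
        Int.add_mul_ediv_left _ _ hn0, Int.add_mul_ediv_left _ _ hn0,
        Int.add_mul_ediv_left _ _ hn0, hneg, h1n, hm1n, hc,
        show -f - 1 + (y - x) - (0 + (y - x)) = -(f + 1) by ring,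
        show -f - 1 + (y - x) - (-1 + (y - x)) = -f by ring, abs_neg, abs_neg]
      ring
    rw [simpleReflection_sub_ediv hn k h1 h2, ← ite_and, ← ite_and, if_neg h1, if_neg h2]
    ring
  have pull : ∀ (P : Prop) [Decidable P] (Q : ℤ → Prop) [DecidablePred Q],
      ∑ j ∈ Finset.Icc (1 : ℤ) n, (if P then (if Q j then c else 0) else 0) =
        if P then ∑ j ∈ Finset.Icc (1 : ℤ) n, (if Q j then c else 0) else 0 := by
    intro P _ Q _
    split_ifs <;> simp
  rw [inversionSum_mul_simpleReflection_eq hn hw]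
  simp only [key, Finset.sum_add_distrib, pull]
  simp only [sum_Icc_ite_modEq (show 0 < n by omega)]
  rw [inversionSum]
  ring

theorem inversionSum_mul_of_lt {n : ℕ} (hn : 2 ≤ n) {w : Equiv.Perm ℤ}
    (hw : ∀ i, w (i + n) = w i + n) {k : ℕ} (h : w k < w (k + 1)) :
    inversionSum n (w * simpleReflection n hn k) = inversionSum n w + 2 := by
  rw [inversionSum_mul_simpleReflection hn hw]
  have : 0 ≤ (w (k + 1) - w k) / (n : ℤ) := Int.ediv_nonneg (by omega) (by omega)
  rw [abs_of_nonneg this, abs_of_nonneg (by omega)]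
  ring

theorem inversionSum_mul_of_gt {n : ℕ} (hn : 2 ≤ n) {w : Equiv.Perm ℤ}
    (hw : ∀ i, w (i + n) = w i + n) {k : ℕ} (h : w (k + 1) < w k) :
    inversionSum n (w * simpleReflection n hn k) = inversionSum n w - 2 := by
  rw [inversionSum_mul_simpleReflection hn hw]
  have : (w (k + 1) - w k) / (n : ℤ) < 0 := Int.ediv_neg_of_neg_of_pos (by omega) (by omega)
  rw [abs_of_neg this, abs_of_nonpos (by omega)]
  ring

theorem apply_lt_or_gt (w : Equiv.Perm ℤ) (k : ℤ) : w k < w (k + 1) ∨ w (k + 1) < w k :=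
  lt_or_gt_of_ne fun h => by have := w.injective h; omega

/-- A permutation of `ℤ` in the affine symmetric group without descents is the identity. -/
theorem eq_one_of_forall_lt {n : ℕ} (hn : 2 ≤ n) {w : Equiv.Perm ℤ}
    (hw : w ∈ affineSymmetricGroup n) (h : ∀ k : ℕ, k < n → w k < w (k + 1)) : w = 1 := by
  have hmono : StrictMono w := by
    refine strictMono_of_lt_succ fun x _ => ?_
    rw [Order.succ_eq_add_one]
    have h1 := Int.emod_nonneg x (show (n : ℤ) ≠ 0 by omega)
    have h2 := Int.emod_lt_of_pos x (show (0 : ℤ) < n by omega)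
    have h3 := h (x % n).toNat (by omega)
    rw [Int.toNat_of_nonneg h1] at h3
    have h4 := Int.emod_add_mul_ediv x n
    have h5 : w x = w (x % n) + n * (x / n) := by rw [← perm_apply_add_mul hw.1, h4]
    have h6 : w (x + 1) = w (x % n + 1) + n * (x / n) := by
      rw [← perm_apply_add_mul hw.1, add_right_comm, h4]
    rw [h5, h6]
    linarith
  -- An order automorphism of `ℤ` is a translation.
  have hstep : ∀ x, w (x + 1) = w x + 1 := by
    intro x
    obtain ⟨y, hy⟩ := w.surjective (w x + 1)
    have h1 : x < y := hmono.lt_iff_lt.1 (by omega)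
    have h2 := hmono.monotone (show x + 1 ≤ y by omega)
    have h3 := hmono (show x < x + 1 by omega)
    omega
  have htrans : ∀ x, w x = x + w 0 := by
    intro x
    induction x using Int.induction_on with
    | zero => simp
    | succ k ih => rw [hstep, ih]; ring
    | pred k ih =>
      have := hstep (-(k : ℤ) - 1)
      rw [sub_add_cancel, ih] at this
      linarith
  have hsum := hw.2
  rw [Finset.sum_congr rfl fun x _ => htrans x, Finset.sum_add_distrib, Finset.sum_const,
    Int.card_Icc, add_eq_left, nsmul_eq_mul, mul_eq_zero] at hsum
  have h0 : w 0 = 0 := hsum.resolve_left (by simp; omega)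
  exact Equiv.ext fun x => by rw [htrans, h0]; simp

theorem prod_simpleReflection_mem {n : ℕ} (hn : 2 ≤ n) (l : List ℕ) :
    (l.map (simpleReflection n hn)).prod ∈ affineSymmetricGroup n := by
  refine Subgroup.list_prod_mem _ fun x hx => ?_
  obtain ⟨i, _, rfl⟩ := List.mem_map.1 hx
  exact simpleReflection_mem hn i

theorem inversionSum_prod_le {n : ℕ} (hn : 2 ≤ n) (l : List ℕ) :
    inversionSum n (l.map (simpleReflection n hn)).prod ≤ 2 * l.length := by
  induction l using List.reverseRecOn with
  | nil => simp [inversionSum_one]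
  | append_singleton l k ih =>
    have hw := (prod_simpleReflection_mem hn l).1
    simp only [List.map_append, List.map_cons, List.map_nil, List.prod_append, List.prod_singleton,
      List.length_append, List.length_singleton]
    push_cast
    rcases apply_lt_or_gt (l.map (simpleReflection n hn)).prod k with h | h
    · rw [inversionSum_mul_of_lt hn hw h]; linarith
    · rw [inversionSum_mul_of_gt hn hw h]; linarith

/-- Sorting `w` by removing descents one at a time produces a word whose length is the number of
inversions. -/
theorem exists_word {n : ℕ} (hn : 2 ≤ n) (d : ℕ) :
    ∀ w ∈ affineSymmetricGroup n, inversionSum n w ≤ d →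
      ∃ l : List ℕ, 2 * (l.length : ℤ) = inversionSum n w ∧ (∀ i ∈ l, i < n) ∧
        (l.map (simpleReflection n hn)).prod = w := by
  induction d with
  | zero =>
    intro w hw hd
    refine ⟨[], ?_, by simp, ?_⟩
    · have := inversionSum_nonneg n w
      simp only [List.length_nil]
      push_cast at hd ⊢
      omega
    · refine (eq_one_of_forall_lt hn hw fun k hk => ?_).symm
      refine (apply_lt_or_gt w k).resolve_right fun h => ?_
      have h1 := inversionSum_mul_of_gt hn hw.1 h
      have h2 := inversionSum_nonneg n (w * simpleReflection n hn k)
      push_cast at hd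
      omega
  | succ d ih =>
    intro w hw hd
    by_cases hdesc : ∀ k : ℕ, k < n → w k < w (k + 1)
    · obtain rfl := eq_one_of_forall_lt hn hw hdesc
      exact ⟨[], by simp [inversionSum_one], by simp, by simp⟩
    push Not at hdesc
    obtain ⟨k, hk, hle⟩ := hdesc
    have h1 := inversionSum_mul_of_gt hn hw.1 ((apply_lt_or_gt w k).resolve_left (by omega))
    obtain ⟨l, hl1, hl2, hl3⟩ := ih (w * simpleReflection n hn k)
      (mul_mem hw (simpleReflection_mem hn k)) (by push_cast at hd; omega)
    refine ⟨l ++ [k], ?_, ?_, ?_⟩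
    · simp only [List.length_append, List.length_singleton]
      push_cast
      omega
    · intro i hi
      rcases List.mem_append.1 hi with hi | hi
      · exact hl2 i hi
      · rw [List.mem_singleton.1 hi]; exact hk
    · rw [List.map_append, List.prod_append, hl3]
      simp [mul_assoc, simpleReflection_mul_self]

/-- The Coxeter length is the number of inversions. -/
theorem two_mul_affineLength {n : ℕ} (hn : 2 ≤ n) {w : Equiv.Perm ℤ}
    (hw : w ∈ affineSymmetricGroup n) : 2 * (affineLength n hn w : ℤ) = inversionSum n w := by
  obtain ⟨l, hl1, hl2, hl3⟩ := exists_word hn (inversionSum n w).toNat w hw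
    (Int.self_le_toNat _)
  have hmem : l.length ∈ {k | ∃ l : List ℕ, l.length = k ∧ (∀ i ∈ l, i < n) ∧
    (l.map (simpleReflection n hn)).prod = w} := ⟨l, rfl, hl2, hl3⟩
  have hle : affineLength n hn w ≤ l.length := Nat.sInf_le hmem
  obtain ⟨l', hl1', _, hl3'⟩ := Nat.sInf_mem ⟨_, hmem⟩
  have hge := inversionSum_prod_le hn l'
  rw [hl3', hl1'] at hge
  change inversionSum n w ≤ 2 * (affineLength n hn w : ℤ) at hge
  omega

theorem affineLength_inv {n : ℕ} (hn : 2 ≤ n) (w : Equiv.Perm ℤ) :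
    affineLength n hn w⁻¹ = affineLength n hn w := by
  have key : ∀ (k : ℕ) (v : Equiv.Perm ℤ), (∃ l : List ℕ, l.length = k ∧ (∀ i ∈ l, i < n) ∧
      (l.map (simpleReflection n hn)).prod = v) → ∃ l : List ℕ, l.length = k ∧ (∀ i ∈ l, i < n) ∧
      (l.map (simpleReflection n hn)).prod = v⁻¹ := by
    rintro k v ⟨l, h1, h2, rfl⟩
    refine ⟨l.reverse, by simpa using h1, by simpa using h2, ?_⟩
    rw [List.prod_inv_reverse, List.map_map, List.map_reverse]
    congr 3
  unfold affineLength
  congr 1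
  ext k
  exact ⟨fun h => by simpa using key k _ h, key k w⟩

theorem affineLength_mul_simpleReflection_iff {n : ℕ} (hn : 2 ≤ n) {w : Equiv.Perm ℤ}
    (hw : w ∈ affineSymmetricGroup n) (k : ℕ) :
    affineLength n hn (w * simpleReflection n hn k) = affineLength n hn w + 1 ↔
      w k < w (k + 1) := by
  have h1 := two_mul_affineLength hn hw
  have h2 := two_mul_affineLength hn (mul_mem hw (simpleReflection_mem hn k))
  rcases apply_lt_or_gt w k with h | h
  · have h3 := inversionSum_mul_of_lt hn hw.1 h
    exact ⟨fun _ => h, fun _ => by omega⟩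
  · have h3 := inversionSum_mul_of_gt hn hw.1 h
    exact ⟨fun _ => by omega, fun _ => by omega⟩

theorem affineLength_simpleReflection_mul_iff {n : ℕ} (hn : 2 ≤ n) {w : Equiv.Perm ℤ}
    (hw : w ∈ affineSymmetricGroup n) (k : ℕ) :
    affineLength n hn (simpleReflection n hn k * w) = affineLength n hn w + 1 ↔
      w⁻¹ k < w⁻¹ (k + 1) := by
  rw [← affineLength_mul_simpleReflection_iff hn (inv_mem hw), affineLength_inv,
    ← affineLength_inv hn (w⁻¹ * _), mul_inv_rev, inv_inv, simpleReflection_inv]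

theorem strictMonoOn_Icc_iff (n : ℕ) (w : Equiv.Perm ℤ) :
    StrictMonoOn w (Set.Icc 1 (n : ℤ)) ↔ ∀ k : ℕ, 1 ≤ k → k ≤ n - 1 → w k < w (k + 1) := by
  constructor
  · intro h k hk1 hk2
    exact h ⟨by omega, by omega⟩ ⟨by omega, by omega⟩ (by omega)
  · intro h
    refine strictMonoOn_of_lt_add_one Set.ordConnected_Icc fun x _ hx hx' => ?_
    obtain ⟨k, rfl⟩ := Int.eq_ofNat_of_zero_le (show 0 ≤ x by have := hx.1; omega)
    have h1 := hx.1
    have h2 := hx'.2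
    exact h k (by omega) (by omega)

/-- Minimal double coset representatives are the `w` such that `w` and `w⁻¹` are increasing on
`[n]`. -/
theorem isMinimalRep_iff {n : ℕ} (hn : 2 ≤ n) {w : Equiv.Perm ℤ}
    (hw : w ∈ affineSymmetricGroup n) :
    IsMinimalRep n hn w ↔
      StrictMonoOn w (Set.Icc 1 (n : ℤ)) ∧ StrictMonoOn ⇑w⁻¹ (Set.Icc 1 (n : ℤ)) := by
  rw [strictMonoOn_Icc_iff, strictMonoOn_Icc_iff]
  simp only [IsMinimalRep, affineLength_mul_simpleReflection_iff hn hw,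
    affineLength_simpleReflection_mul_iff hn hw]
  exact ⟨fun h => ⟨fun k a b => (h k a b).2, fun k a b => (h k a b).1⟩,
    fun h k a b => ⟨h.2 k a b, h.1 k a b⟩⟩

/-! ### The sequence of quotients -/

/-- The position `u ∈ [n]` congruent to `w t`, so that `w t = n λ_t + u`. As for `lam`, a position
`t ∈ [n]` is the element `t - 1` of `Fin n`. -/
def residue {n : ℕ} (hn : 0 < n) (w : Equiv.Perm ℤ) (p : Fin n) : Fin n :=
  ⟨((w ((p : ℤ) + 1) - 1) % n).toNat, by
    have h1 := Int.emod_nonneg (w ((p : ℤ) + 1) - 1) (show (n : ℤ) ≠ 0 by omega)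
    have h2 := Int.emod_lt_of_pos (w ((p : ℤ) + 1) - 1) (show (0 : ℤ) < n by omega)
    omega⟩

theorem apply_eq_lam_add_residue {n : ℕ} (hn : 0 < n) (w : Equiv.Perm ℤ) (p : Fin n) :
    w ((p : ℤ) + 1) = n * lam n w p + ((residue hn w p : ℕ) + 1) := by
  have h1 := Int.emod_nonneg (w ((p : ℤ) + 1) - 1) (show (n : ℤ) ≠ 0 by omega)
  have h2 := Int.emod_add_mul_ediv (w ((p : ℤ) + 1) - 1) n
  simp only [lam, residue]
  rw [Int.toNat_of_nonneg h1]
  linarith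

theorem lam_residue_unique {n : ℕ} (hn : 0 < n) {w : Equiv.Perm ℤ} {p q : Fin n} {v : ℤ}
    (h : w ((p : ℤ) + 1) = n * v + ((q : ℕ) + 1)) : lam n w p = v ∧ residue hn w p = q := by
  have hq : ((q : ℕ) : ℤ) < n := by exact_mod_cast q.2
  have hv : lam n w p = v := by
    rw [lam, h, show (n : ℤ) * v + ((q : ℕ) + 1) - 1 = (q : ℕ) + n * v by ring,
      Int.add_mul_ediv_left _ _ (by omega), Int.ediv_eq_zero_of_lt (by positivity) hq, zero_add]
  refine ⟨hv, Fin.ext ?_⟩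
  have h2 := apply_eq_lam_add_residue hn w p
  rw [hv, h] at h2
  omega

/-- The residues of `w 1, …, w n` are a permutation of `[n]`, so only the quotients `λ_i` change the
sum of the values. -/
theorem sum_apply_eq {n : ℕ} {w : Equiv.Perm ℤ} (hw : ∀ i, w (i + n) = w i + n) :
    ∑ i ∈ Finset.Icc (1 : ℤ) n, w i = ∑ i ∈ Finset.Icc (1 : ℤ) n, i + n * ∑ p, lam n w p := by
  have h1 := sum_Icc_comp_of_periodic n (fun i => (i - 1) % n)
    (fun i => by rw [add_sub_right_comm, Int.add_emod_right]) w hw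
  have h2 : ∑ i ∈ Finset.Icc (1 : ℤ) n, (i - 1) % (n : ℤ) = ∑ i ∈ Finset.Icc (1 : ℤ) n, (i - 1) := by
    refine Finset.sum_congr rfl fun i hi => ?_
    rw [Finset.mem_Icc] at hi
    exact Int.emod_eq_of_lt (by omega) (by omega)
  have h3 : ∑ p, lam n w p = ∑ i ∈ Finset.Icc (1 : ℤ) n, (w i - 1) / (n : ℤ) :=
    (sum_Icc_eq_sum_fin n fun i => (w i - 1) / (n : ℤ)).symm
  have h4 : ∑ i ∈ Finset.Icc (1 : ℤ) n, (w i - 1) =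
      ∑ i ∈ Finset.Icc (1 : ℤ) n, (w i - 1) % (n : ℤ) +
        n * ∑ i ∈ Finset.Icc (1 : ℤ) n, (w i - 1) / (n : ℤ) := by
    rw [Finset.mul_sum, ← Finset.sum_add_distrib]
    exact Finset.sum_congr rfl fun i _ => (Int.emod_add_mul_ediv _ _).symm
  rw [h1, h2] at h4
  simp only [Finset.sum_sub_distrib] at h4
  rw [h3]
  linarith

theorem mem_affineSymmetricGroup_iff {n : ℕ} (hn : 0 < n) {w : Equiv.Perm ℤ} :
    w ∈ affineSymmetricGroup n ↔ (∀ i, w (i + n) = w i + n) ∧ ∑ p, lam n w p = 0 := by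
  have hn0 : (n : ℤ) ≠ 0 := by omega
  constructor
  · rintro ⟨h1, h2⟩
    refine ⟨h1, ?_⟩
    rw [sum_apply_eq h1, add_eq_left, mul_eq_zero] at h2
    exact h2.resolve_left hn0
  · rintro ⟨h1, h2⟩
    refine ⟨h1, ?_⟩
    rw [sum_apply_eq h1, h2]
    ring

theorem perm_eq_of_forall_index {n : ℕ} (hn : 0 < n) {w v : Equiv.Perm ℤ}
    (hw : ∀ i, w (i + n) = w i + n) (hv : ∀ i, v (i + n) = v i + n)
    (h : ∀ p : Fin n, w ((p : ℤ) + 1) = v ((p : ℤ) + 1)) : w = v := by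
  ext x
  obtain ⟨k, p, rfl⟩ := exists_eq_mul_add_index hn x
  have := h p
  push_cast
  rw [add_comm, perm_apply_add_mul hw, perm_apply_add_mul hv, this]

theorem strictMonoOn_Icc_index_iff {n : ℕ} {w : Equiv.Perm ℤ} :
    StrictMonoOn w (Set.Icc 1 (n : ℤ)) ↔ StrictMono fun p : Fin n => w ((p : ℤ) + 1) := by
  constructor
  · intro h p q hpq
    have hp := p.2
    have hq := q.2
    have : (p : ℕ) < q := hpq
    exact h ⟨by omega, by omega⟩ ⟨by omega, by omega⟩ (by omega)
  · rintro h x ⟨hx1, hx2⟩ y ⟨hy1, hy2⟩ hxy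
    have := @h ⟨(x - 1).toNat, by omega⟩ ⟨(y - 1).toNat, by omega⟩ (by
      rw [Fin.mk_lt_mk]; omega)
    simp only at this
    rwa [Int.toNat_of_nonneg (by omega), Int.toNat_of_nonneg (by omega), sub_add_cancel,
      sub_add_cancel] at this

theorem lam_monotone {n : ℕ} {w : Equiv.Perm ℤ} (hw : StrictMonoOn w (Set.Icc 1 (n : ℤ))) :
    Monotone (lam n w) := by
  intro p q hpq
  have h := (strictMonoOn_Icc_index_iff.1 hw).monotone hpq
  exact Int.ediv_le_ediv (by have := p.2; omega) (by omega)

/-! ### The permutation attached to a sequence -/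

theorem blockPerm_apply_index {n : ℕ} (hn : 2 ≤ n) (a : Fin n → ℤ) (p : Fin n) :
    blockPerm hn a ((p : ℤ) + 1) =
      n * a p + ((p : ℕ) + 1 + n - blockLower a (p + 1) - blockUpper a (p + 1)) := by
  have h := blockMap_apply hn a 0 p
  change blockMap hn a _ = _
  simp only [mul_zero, zero_add, blockMapAux] at h
  push_cast at h
  rw [h]

theorem blockPerm_add {n : ℕ} (hn : 2 ≤ n) (a : Fin n → ℤ) (x : ℤ) :
    blockPerm hn a (x + n) = blockPerm hn a x + n := by
  change blockMap hn a (x + n) = blockMap hn a x + n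
  obtain ⟨k, p, rfl⟩ := exists_eq_mul_add_index (show 0 < n by omega) x
  rw [show (n : ℤ) * k + ((p : ℕ) + 1 : ℕ) + n = n * (k + 1) + ((p : ℕ) + 1 : ℕ) by ring,
    blockMap_apply, blockMap_apply, blockMapAux, blockMapAux]
  ring

theorem lam_blockPerm {n : ℕ} (hn : 2 ≤ n) (a : Fin n → ℤ) : lam n (blockPerm hn a) = a := by
  funext p
  have h1 := blockLower_lt a (t := p + 1) (by omega)
  have h2 := blockUpper_spec a (t := p + 1) (by omega) p.2
  have hq : (p : ℕ) + n - blockLower a (p + 1) - blockUpper a (p + 1) < n := by omega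
  refine (lam_residue_unique (show 0 < n by omega) (q := ⟨_, hq⟩) ?_).1
  rw [blockPerm_apply_index]
  simp only
  omega

/-- Adjacent positions with equal entries lie in the same block. -/
theorem block_eq_of_eq {n : ℕ} {a : Fin n → ℤ} {p q : Fin n} (hpq : (q : ℕ) = p + 1)
    (h : a p = a q) :
    blockLower a (q + 1) = blockLower a (p + 1) ∧ blockUpper a (q + 1) = blockUpper a (p + 1) := by
  have h1 := blockLower_lt a (t := p + 1) (by omega)
  have h2 := blockUpper_spec a (t := p + 1) (by omega) p.2
  refine block_congr a (by omega) p.2 (by omega) ?_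
  rcases Nat.lt_or_ge (p + 1) (blockUpper a (p + 1)) with h3 | h3
  · omega
  · exfalso
    have h4 := h2.1
    rw [show blockUpper a (p + 1) = p + 1 by omega, blockEnds, Finset.mem_image] at h4
    obtain ⟨r, hr, hrp⟩ := h4
    obtain rfl : r = p := Fin.ext (by omega)
    exact (Finset.mem_filter.1 hr).2 q hpq h

theorem block_eq_of_monotone {n : ℕ} {a : Fin n → ℤ} (ha : Monotone a) {p q : Fin n} (hpq : p ≤ q)
    (h : a p = a q) :
    blockLower a (q + 1) = blockLower a (p + 1) ∧ blockUpper a (q + 1) = blockUpper a (p + 1) := by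
  obtain ⟨d, hd⟩ := Nat.exists_eq_add_of_le (show (p : ℕ) ≤ q from hpq)
  induction d generalizing q with
  | zero => obtain rfl : q = p := Fin.ext (by omega); exact ⟨rfl, rfl⟩
  | succ d ih =>
    have hq := q.2
    let r : Fin n := ⟨p + d, by omega⟩
    have hpr : p ≤ r := Fin.le_def.2 (by simp [r])
    have hrq : r ≤ q := Fin.le_def.2 (by simp only [r]; omega)
    have hr : a p = a r := le_antisymm (ha hpr) ((ha hrq).trans h.ge)
    obtain ⟨i1, i2⟩ := ih hpr hr rfl
    obtain ⟨j1, j2⟩ := block_eq_of_eq (a := a) (p := r) (q := q) (by simp only [r]; omega)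
      (hr.symm.trans h)
    exact ⟨j1.trans i1, j2.trans i2⟩

theorem mem_block_of_monotone {n : ℕ} {a : Fin n → ℤ} (ha : Monotone a) {p q : Fin n}
    (h : a q = a p) : blockLower a (p + 1) < q + 1 ∧ (q : ℕ) + 1 ≤ blockUpper a (p + 1) := by
  have h1 := blockLower_lt a (t := q + 1) (by omega)
  have h2 := blockUpper_spec a (t := q + 1) (by omega) q.2
  rcases le_total p q with hpq | hpq
  · have := block_eq_of_monotone ha hpq h.symm
    omega
  · have := block_eq_of_monotone ha hpq h
    omega

/-- Within a block `w_a` is a translation; between blocks the values of `a` increase by at least one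
and the residues stay in `[n]`. -/
theorem strictMonoOn_blockPerm {n : ℕ} (hn : 2 ≤ n) {a : Fin n → ℤ} (ha : Monotone a) :
    StrictMonoOn (blockPerm hn a) (Set.Icc 1 (n : ℤ)) := by
  rw [strictMonoOn_Icc_index_iff]
  intro p q hpq
  have hpq' : (p : ℕ) < q := hpq
  have hp1 := blockLower_lt a (t := p + 1) (by omega)
  have hp2 := blockUpper_spec a (t := p + 1) (by omega) p.2
  have hq1 := blockLower_lt a (t := q + 1) (by omega)
  have hq2 := blockUpper_spec a (t := q + 1) (by omega) q.2
  simp only [blockPerm_apply_index]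
  rcases (ha hpq.le).eq_or_lt with h | h
  · obtain ⟨e1, e2⟩ := block_eq_of_monotone ha hpq.le h
    rw [h, e1, e2]
    omega
  · have : (n : ℤ) * (a p + 1) ≤ n * a q := mul_le_mul_of_nonneg_left (by omega) (by omega)
    rw [mul_add] at this
    omega

/-- A strictly decreasing self-map of an interval of integers is the reflection of the
interval. -/
theorem strictAntiOn_Ioc_eq {L U : ℤ} {r : ℤ → ℤ} (hr : StrictAntiOn r (Set.Ioc L U))
    (hm : Set.MapsTo r (Set.Ioc L U) (Set.Ioc L U)) {t : ℤ} (ht : t ∈ Set.Ioc L U) :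
    r t = L + U + 1 - t := by
  have key : ∀ (d : ℕ) (s : ℤ), s ∈ Set.Ioc L U → s + d ∈ Set.Ioc L U → r (s + d) + d ≤ r s := by
    intro d
    induction d with
    | zero => intro s _ _; simp
    | succ d ih =>
      intro s hs hs'
      obtain ⟨h1, h2⟩ := hs
      obtain ⟨h3, h4⟩ := hs'
      push_cast at h3 h4 ⊢
      have i1 := ih s ⟨h1, h2⟩ ⟨by omega, by omega⟩
      have i2 := hr (a := s + d) (b := s + (d + 1)) ⟨by omega, by omega⟩ ⟨by omega, by omega⟩
        (by omega)
      omega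
  obtain ⟨h1, h2⟩ := ht
  have k1 := key (t - (L + 1)).toNat (L + 1) ⟨by omega, by omega⟩ ⟨by omega, by omega⟩
  have k2 := key (U - t).toNat t ⟨h1, h2⟩ ⟨by omega, by omega⟩
  rw [show L + 1 + ((t - (L + 1)).toNat : ℤ) = t by omega] at k1
  rw [show t + ((U - t).toNat : ℤ) = U by omega] at k2
  have m1 := (hm (show L + 1 ∈ Set.Ioc L U from ⟨by omega, by omega⟩)).2
  have m2 := (hm (show U ∈ Set.Ioc L U from ⟨by omega, by omega⟩)).1
  omega

/-- If `w` is increasing on `[n]` and the residue of `w t` lies in `J_i` whenever `t` lies in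
`I_i`, then `w` is the permutation attached to `λ(w)`: on the block `I_i` the map
`t ↦ n + 1 - residue` is a strictly decreasing self-map, hence a reflection. -/
theorem blockPerm_lam_of_residue {n : ℕ} (hn : 2 ≤ n) {w : Equiv.Perm ℤ}
    (hw : ∀ i, w (i + n) = w i + n) (hmono : StrictMonoOn w (Set.Icc 1 (n : ℤ)))
    (hres : ∀ p : Fin n, lam n w (residue (by omega) w p).rev = lam n w p) :
    blockPerm hn (lam n w) = w := by
  have hn0 : 0 < n := by omega
  refine perm_eq_of_forall_index hn0 (blockPerm_add hn _) hw fun p => ?_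
  rw [blockPerm_apply_index]
  set a := lam n w with ha
  have hamono : Monotone a := lam_monotone hmono
  set L := blockLower a (p + 1) with hL
  set U := blockUpper a (p + 1) with hU
  have hU2 := blockUpper_spec a (t := p + 1) (by omega) p.2
  have hL2 := blockLower_lt a (t := p + 1) (by omega)
  let r : ℤ → ℤ := fun t => n * a p + (n + 1) - w t
  -- The constant in `r` makes `r t` an element of `[n]`: on the block of `p + 1` the integer
  -- `r t` is the reflected residue of `w t`.
  have hr : ∀ t ∈ Set.Ioc (L : ℤ) U, ∃ q : Fin n, t = (q : ℤ) + 1 ∧ a q = a p ∧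
      r t = ((residue hn0 w q).rev : ℕ) + 1 := by
    rintro t ⟨h1, h2⟩
    refine ⟨⟨(t - 1).toNat, by omega⟩, by simp only; omega, ?_⟩
    set q : Fin n := ⟨(t - 1).toNat, by omega⟩ with hq
    have hqt : (q : ℤ) + 1 = t := by simp only [hq]; omega
    have haq : a q = a p := block_value a (t := p + 1) _ _ (by simp only [hq]; omega)
      (by simp only [hq]; omega) (by omega) (by omega)
    refine ⟨haq, ?_⟩
    have h3 := apply_eq_lam_add_residue hn0 w q
    have h4 := (residue hn0 w q).2
    rw [hqt, ← ha, haq] at h3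
    simp only [r, Fin.val_rev, h3]
    omega
  have hanti : StrictAntiOn r (Set.Ioc (L : ℤ) U) := by
    intro x hx y hy hxy
    have h := hmono (a := x) (b := y) ⟨by have := hx.1; omega, by have := hx.2; omega⟩
      ⟨by have := hy.1; omega, by have := hy.2; omega⟩ hxy
    simp only [r]
    omega
  have hmaps : Set.MapsTo r (Set.Ioc (L : ℤ) U) (Set.Ioc (L : ℤ) U) := by
    intro t ht
    obtain ⟨q, -, haq, hrt⟩ := hr t ht
    obtain ⟨h1, h2⟩ := mem_block_of_monotone hamono ((hres q).trans haq)
    rw [hrt]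
    exact ⟨by omega, by omega⟩
  have h := strictAntiOn_Ioc_eq hanti hmaps (t := (p : ℤ) + 1) ⟨by omega, by omega⟩
  simp only [r] at h
  linarith

/-! ### Twisted involutions -/

theorem tauPerm_apply (n : ℕ) (x : ℤ) : tauPerm n x = n + 1 - x := rfl

theorem tauPerm_mul_sq_iff (n : ℕ) (w : Equiv.Perm ℤ) :
    (tauPerm n * w) ^ 2 = 1 ↔ w⁻¹ = tauPerm n * w * tauPerm n := by
  rw [sq, ← mul_assoc, mul_eq_one_iff_eq_inv, eq_comm]

theorem strictMonoOn_tauPerm_conj {n : ℕ} {w : Equiv.Perm ℤ}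
    (h : StrictMonoOn w (Set.Icc 1 (n : ℤ))) :
    StrictMonoOn ⇑(tauPerm n * w * tauPerm n) (Set.Icc 1 (n : ℤ)) := by
  rintro x ⟨hx1, hx2⟩ y ⟨hy1, hy2⟩ hxy
  have := h (a := n + 1 - y) (b := n + 1 - x) ⟨by omega, by omega⟩ ⟨by omega, by omega⟩ (by omega)
  simp only [Equiv.Perm.mul_apply, tauPerm_apply]
  omega

theorem blockPerm_mem_OmegaTwisted {n : ℕ} (hn : 2 ≤ n) {a : Fin n → ℤ} (ha : Monotone a)
    (hs : ∑ p, a p = 0) : blockPerm hn a ∈ OmegaTwisted n hn := by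
  have hmem : blockPerm hn a ∈ affineSymmetricGroup n :=
    (mem_affineSymmetricGroup_iff (by omega)).2 ⟨blockPerm_add hn a, by rwa [lam_blockPerm]⟩
  have hsq : (tauPerm n * blockPerm hn a) ^ 2 = 1 := by
    ext x
    rw [sq]
    exact tau_blockMap_involutive hn a x
  refine ⟨hmem, hsq, (isMinimalRep_iff hn hmem).2 ⟨strictMonoOn_blockPerm hn ha, ?_⟩⟩
  rw [(tauPerm_mul_sq_iff n _).1 hsq]
  exact strictMonoOn_tauPerm_conj (strictMonoOn_blockPerm hn ha)

/-- If `w t = n v + u`, then `(τ_n w)² = 1` gives `w (n + 1 - u) = n v + (n + 1 - t)`, so that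
`n + 1 - u` has the same quotient as `t`. -/
theorem blockPerm_lam_of_mem_OmegaTwisted {n : ℕ} (hn : 2 ≤ n) {w : Equiv.Perm ℤ}
    (hw : w ∈ OmegaTwisted n hn) : blockPerm hn (lam n w) = w := by
  obtain ⟨hmem, hsq, hmin⟩ := hw
  have hn0 : 0 < n := by omega
  refine blockPerm_lam_of_residue hn hmem.1 ((isMinimalRep_iff hn hmem).1 hmin).1 fun p => ?_
  have h1 := apply_eq_lam_add_residue hn0 w p
  have h2 : (n : ℤ) + 1 - w (n + 1 - w ((p : ℤ) + 1)) = (p : ℤ) + 1 := by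
    have := Equiv.ext_iff.1 hsq ((p : ℤ) + 1)
    rwa [sq] at this
  have hu := (residue hn0 w p).2
  refine (lam_residue_unique hn0 (q := p.rev) ?_).1
  have h3 : (n : ℤ) + 1 - w ((p : ℤ) + 1) =
      (((residue hn0 w p).rev : ℕ) : ℤ) + 1 + n * (-lam n w p) := by
    rw [h1, Fin.val_rev]
    push_cast [Nat.cast_sub (show (residue hn0 w p : ℕ) + 1 ≤ n by omega)]
    ring
  rw [h3, perm_apply_add_mul hmem.1] at h2
  rw [Fin.val_rev p]
  push_cast [Nat.cast_sub (show (p : ℕ) + 1 ≤ n from p.2)]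
  linarith

/-! ### Involutions -/

/-- For an involution `w`, the residue map of `w` carries the positions where `λ` equals `v`
bijectively to those where it equals `-v`. -/
theorem residue_of_sq_eq_one {n : ℕ} (hn : 0 < n) {w : Equiv.Perm ℤ}
    (hw : ∀ i, w (i + n) = w i + n) (hsq : w ^ 2 = 1) (p : Fin n) :
    lam n w (residue hn w p) = -lam n w p ∧ residue hn w (residue hn w p) = p := by
  refine lam_residue_unique hn ?_
  have h1 := apply_eq_lam_add_residue hn w p
  have h2 : w (w ((p : ℤ) + 1)) = (p : ℤ) + 1 := by
    have := Equiv.ext_iff.1 hsq ((p : ℤ) + 1)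
    rwa [sq] at this
  rw [h1, add_comm, perm_apply_add_mul hw] at h2
  linarith

/-- For an involution, `λ(w)` and its negated reversal have the same multiset of entries by
`residue_of_sq_eq_one`; both are weakly increasing, so they agree. -/
theorem isAntisymmSeq_lam {n : ℕ} (hn : 0 < n) {w : Equiv.Perm ℤ}
    (hw : ∀ i, w (i + n) = w i + n) (hsq : w ^ 2 = 1) (hmono : Monotone (lam n w)) :
    IsAntisymmSeq (lam n w) := by
  have hr := residue_of_sq_eq_one hn hw hsq
  have hinv : Function.Involutive (residue hn w) := fun p => (hr p).2
  let σ : Equiv.Perm (Fin n) := Fin.revPerm.trans hinv.toPerm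
  have hσ : lam n w ∘ σ = fun p => -lam n w p.rev := funext fun p => (hr p.rev).1
  have h := Tuple.unique_monotone (f := lam n w) (σ := σ) (τ := 1)
    (by
      rw [hσ]
      exact fun p q hpq => neg_le_neg (hmono (Fin.rev_le_rev.2 hpq)))
    (by simpa using hmono)
  intro p
  have h2 := congrFun (hσ.symm.trans h) p
  simp only [Function.comp_apply, Equiv.Perm.one_apply] at h2
  linarith

theorem lam_tauPerm_conj {n : ℕ} (hn : 0 < n) (w : Equiv.Perm ℤ) (p : Fin n) :
    lam n (tauPerm n * w * tauPerm n) p = -lam n w p.rev := by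
  have h1 := apply_eq_lam_add_residue hn w p.rev
  have hu := (residue hn w p.rev).2
  refine (lam_residue_unique hn (q := (residue hn w p.rev).rev) ?_).1
  have h2 : (n : ℤ) + 1 - ((p : ℤ) + 1) = (p.rev : ℕ) + 1 := by
    rw [Fin.val_rev]
    push_cast [Nat.cast_sub (show (p : ℕ) + 1 ≤ n from p.2)]
    ring
  simp only [Equiv.Perm.mul_apply, tauPerm_apply]
  rw [h2, h1, Fin.val_rev (residue hn w p.rev)]
  push_cast [Nat.cast_sub (show (residue hn w p.rev : ℕ) + 1 ≤ n from hu)]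
  ring

theorem sum_eq_zero_of_isAntisymmSeq {n : ℕ} {a : Fin n → ℤ} (ha : IsAntisymmSeq a) :
    ∑ p, a p = 0 := by
  have h1 : ∑ p : Fin n, a p.rev = ∑ p, a p := Equiv.sum_comp Fin.revPerm a
  have h2 : ∑ p, (a p + a p.rev) = 0 := Finset.sum_eq_zero fun p _ => ha p
  rw [Finset.sum_add_distrib, h1] at h2
  omega

theorem inv_mem_OmegaTwisted {n : ℕ} {hn : 2 ≤ n} {w : Equiv.Perm ℤ}
    (hw : w ∈ OmegaTwisted n hn) : w⁻¹ ∈ OmegaTwisted n hn := by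
  obtain ⟨hmem, hsq, hmin⟩ := hw
  have hmin' := (isMinimalRep_iff hn hmem).1 hmin
  refine ⟨inv_mem hmem, ?_, (isMinimalRep_iff hn (inv_mem hmem)).2
    ⟨hmin'.2, by rw [inv_inv]; exact hmin'.1⟩⟩
  have h := (tauPerm_mul_sq_iff n w).1 hsq
  rw [tauPerm_mul_sq_iff, inv_inv, h]
  ext x
  simp [tauPerm_apply]

/-- The inverse of `w_a` is its conjugate by `τ_n`, whose sequence of quotients is the negated
reversal of `a`. If `a` is antisymmetric this is `a` again, so `w_a` equals its inverse. -/
theorem blockPerm_mem_Omega {n : ℕ} (hn : 2 ≤ n) {a : Fin n → ℤ} (ha : Monotone a)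
    (hs : IsAntisymmSeq a) : blockPerm hn a ∈ Omega n hn := by
  have hmem := blockPerm_mem_OmegaTwisted hn ha (sum_eq_zero_of_isAntisymmSeq hs)
  refine ⟨hmem.1, ?_, hmem.2.2⟩
  have hlam : lam n (blockPerm hn a)⁻¹ = a := by
    funext p
    rw [(tauPerm_mul_sq_iff n _).1 hmem.2.1, lam_tauPerm_conj (by omega), lam_blockPerm]
    have := hs p
    omega
  have h := blockPerm_lam_of_mem_OmegaTwisted hn (inv_mem_OmegaTwisted hmem)
  rw [hlam] at h
  rw [sq, mul_eq_one_iff_eq_inv]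
  exact h

/-- If `w t = n v + u`, then `u` has quotient `-v` since `w² = 1`, and `n + 1 - u` has quotient `v`
since `λ(w)` is antisymmetric. -/
theorem blockPerm_lam_of_mem_Omega {n : ℕ} (hn : 2 ≤ n) {w : Equiv.Perm ℤ}
    (hw : w ∈ Omega n hn) : blockPerm hn (lam n w) = w := by
  obtain ⟨hmem, hsq, hmin⟩ := hw
  have hn0 : 0 < n := by omega
  have hmono := ((isMinimalRep_iff hn hmem).1 hmin).1
  refine blockPerm_lam_of_residue hn hmem.1 hmono fun p => ?_
  have h1 := isAntisymmSeq_lam hn0 hmem.1 hsq (lam_monotone hmono) (residue hn0 w p)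
  have h2 := (residue_of_sq_eq_one hn0 hmem.1 hsq p).1
  linarith

theorem theorem2 (n : ℕ) (hn : 2 ≤ n) :
    (Set.BijOn (lam n) (OmegaTwisted n hn) {a : Fin n → ℤ | Monotone a ∧ ∑ p, a p = 0} ∧
      Set.BijOn (blockPerm hn) {a : Fin n → ℤ | Monotone a ∧ ∑ p, a p = 0} (OmegaTwisted n hn) ∧
      Set.InvOn (blockPerm hn) (lam n) (OmegaTwisted n hn)
        {a : Fin n → ℤ | Monotone a ∧ ∑ p, a p = 0}) ∧
    (Set.BijOn (lam n) (Omega n hn) {a : Fin n → ℤ | Monotone a ∧ IsAntisymmSeq a} ∧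
      Set.BijOn (blockPerm hn) {a : Fin n → ℤ | Monotone a ∧ IsAntisymmSeq a} (Omega n hn) ∧
      Set.InvOn (blockPerm hn) (lam n) (Omega n hn)
        {a : Fin n → ℤ | Monotone a ∧ IsAntisymmSeq a}) := by
  have hn0 : 0 < n := by omega
  have lamTwisted : Set.MapsTo (lam n) (OmegaTwisted n hn)
      {a : Fin n → ℤ | Monotone a ∧ ∑ p, a p = 0} := fun w hw =>
    ⟨lam_monotone ((isMinimalRep_iff hn hw.1).1 hw.2.2).1,
      ((mem_affineSymmetricGroup_iff hn0).1 hw.1).2⟩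
  have blockTwisted : Set.MapsTo (blockPerm hn) {a : Fin n → ℤ | Monotone a ∧ ∑ p, a p = 0}
      (OmegaTwisted n hn) := fun a ha => blockPerm_mem_OmegaTwisted hn ha.1 ha.2
  have invTwisted : Set.InvOn (blockPerm hn) (lam n) (OmegaTwisted n hn)
      {a : Fin n → ℤ | Monotone a ∧ ∑ p, a p = 0} :=
    ⟨fun w hw => blockPerm_lam_of_mem_OmegaTwisted hn hw, fun a _ => lam_blockPerm hn a⟩
  have lamOmega : Set.MapsTo (lam n) (Omega n hn)
      {a : Fin n → ℤ | Monotone a ∧ IsAntisymmSeq a} := fun w hw =>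
    have hmono := lam_monotone ((isMinimalRep_iff hn hw.1).1 hw.2.2).1
    ⟨hmono, isAntisymmSeq_lam hn0 hw.1.1 hw.2.1 hmono⟩
  have blockOmega : Set.MapsTo (blockPerm hn) {a : Fin n → ℤ | Monotone a ∧ IsAntisymmSeq a}
      (Omega n hn) := fun a ha => blockPerm_mem_Omega hn ha.1 ha.2
  have invOmega : Set.InvOn (blockPerm hn) (lam n) (Omega n hn)
      {a : Fin n → ℤ | Monotone a ∧ IsAntisymmSeq a} :=
    ⟨fun w hw => blockPerm_lam_of_mem_Omega hn hw, fun a _ => lam_blockPerm hn a⟩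
  exact ⟨⟨invTwisted.bijOn lamTwisted blockTwisted,
      invTwisted.symm.bijOn blockTwisted lamTwisted, invTwisted⟩,
    ⟨invOmega.bijOn lamOmega blockOmega, invOmega.symm.bijOn blockOmega lamOmega, invOmega⟩⟩
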